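/- A \emph{tournament} is a directed graph without loops in which every two distinct nodes $i,j$ are joined by exactly one of the edges $(i,j)$, $(j,i)$; all tournaments here are finite. Write $i\succ_T j$ if there is an edge from $i$ to $j$ in $T$, and put $T^+_i=\{j: i\succ_T j\}$. For an integer $r\ge 0$, the \emph{rank $r$ tournament class} consists of the tournaments induced by real skew-symmetric matrices $M\in\mathbb{R}^{n\times n}$ (of any size $n$) of rank $r$ with $M_{ij}\ne 0$ for all $i\neq j$, where the tournament induced by $M$ has nodes $1,\dots,n$ and $i\succ j\iff M_{ij}>0$. A class of tournaments \emph{forbids} a tournament $T$ if no tournament in the class has an induced sub-tournament isomorphic to $T$. A tournament $R$ is \emph{doubly regular} if $|R^+_i|$ is the same for all nodes $i$, and $|R^+_i\cap R^+_j|$ is the same for all pairs $i\neq j$. A tournament $T$ is a \emph{cone over $R$} if it has a node $i^*$ that either beats all other nodes or loses to all other nodes, and the sub-tournament induced on the nodes other than $i^*$ is isomorphic to $R$. \textbf{Theorem.} Let $d\ge 1$ be an integer. If $R$ is a doubly regular tournament on $12d^2-1$ nodes and $T$ is a cone over $R$, then the rank $2(d-1)$ tournament class forbids $T$. -/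

import Mathlib

/-- A tournament on the node set `V`: exactly one of `(i, j)`, `(j, i)` is an edge for each pair of
distinct nodes, and there are no loops. `Adj i j` means that there is an edge from `i` to `j`. -/
structure Tournament (V : Type*) extends Digraph V where
  asymm : ∀ i j, Adj i j → ¬ Adj j i
  total : ∀ i j, i ≠ j → Adj i j ∨ Adj j i

namespace Tournament

/-- The out-neighbours `T⁺ᵢ`. -/
def outNbrs {V : Type*} (T : Tournament V) (i : V) : Set V := {j | T.Adj i j}

/-- The in-neighbours `T⁻ᵢ`. -/
def inNbrs {V : Type*} (T : Tournament V) (i : V) : Set V := {j | T.Adj j i}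

/-- The sub-tournament `T(S)` induced on a set `S` of nodes. -/
def induce {V : Type*} (T : Tournament V) (S : Set V) : Tournament S where
  Adj i j := T.Adj i j
  asymm i j := T.asymm i j
  total i j h := T.total i j (fun e => h (Subtype.ext e))

/-- Two tournaments are isomorphic: some bijection of the nodes preserves and reflects edges. -/
def Isomorphic {V W : Type*} (T : Tournament V) (T' : Tournament W) : Prop :=
  Nonempty (T.Adj ≃r T'.Adj)

/-- A tournament is doubly regular if all out-neighbourhoods have the same size and
any two distinct nodes have the same number of common out-neighbours. -/
def IsDoublyRegular {V : Type*} (T : Tournament V) : Prop :=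
  (∀ i j, (T.outNbrs i).ncard = (T.outNbrs j).ncard) ∧
    ∃ k : ℕ, ∀ i j, i ≠ j → (T.outNbrs i ∩ T.outNbrs j).ncard = k

/-- `T` is an `R`-cone: some node beats all the others, or loses to all the others,
and the other nodes induce a tournament isomorphic to `R`. -/
def IsCone {V W : Type*} (T : Tournament W) (R : Tournament V) : Prop :=
  ∃ i : W,
    ((∀ j, j ≠ i → T.Adj i j) ∧ (T.induce (T.outNbrs i)).Isomorphic R) ∨
    ((∀ j, j ≠ i → T.Adj j i) ∧ (T.induce (T.inNbrs i)).Isomorphic R)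

end Tournament

/-- A skew-symmetric real matrix whose off-diagonal entries are all nonzero. -/
structure IsSkewNonzero {n : ℕ} (M : Matrix (Fin n) (Fin n) ℝ) : Prop where
  skew : M.transpose = -M
  ne_zero : ∀ i j, i ≠ j → M i j ≠ 0

theorem IsSkewNonzero.apply_swap {n : ℕ} {M : Matrix (Fin n) (Fin n) ℝ} (hM : IsSkewNonzero M)
    (i j : Fin n) : M j i = -M i j :=
  congrFun (congrFun hM.skew i) j

/-- The tournament `T{M}` induced by `M`: `i` beats `j` if and only if `M i j > 0`. -/
def Tournament.ofMatrix {n : ℕ} (M : Matrix (Fin n) (Fin n) ℝ) (hM : IsSkewNonzero M) :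
    Tournament (Fin n) where
  Adj i j := 0 < M i j
  asymm i j h := by
    have := hM.apply_swap i j
    linarith
  total i j h := by
    have := hM.apply_swap i j
    rcases lt_or_gt_of_ne (hM.ne_zero i j h) with h' | h'
    · right; linarith
    · left; exact h'

/-- A class of finite tournaments, given by its members on the nodes `Fin n` for every `n`. -/
abbrev TournamentClass := (n : ℕ) → Set (Tournament (Fin n))

/-- The rank `r` tournament class: the tournaments induced by skew-symmetric matrices of rank `r`
(of any size) with nonzero off-diagonal entries. -/
def rankClass (r : ℕ) : TournamentClass := fun _ =>
  {T | ∃ M, ∃ hM : IsSkewNonzero M, M.rank = r ∧ T = Tournament.ofMatrix M hM}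

/-- A class forbids `T` if no member has an induced sub-tournament isomorphic to `T`. -/
def TournamentClass.Forbids {W : Type*} (C : TournamentClass) (T : Tournament W) : Prop :=
  ∀ n : ℕ, ∀ S ∈ C n, ∀ U : Set (Fin n), ¬ (S.induce U).Isomorphic T

/-!
The proof is Forster's lower bound for sign rank, applied to the sign matrix `S` of the cone.
Counting edges determines the parameters of a doubly regular tournament, and then `S` is a skew
conference matrix: `S Sᵀ = (n - 1) I` with `n = 12 d ^ 2` the number of nodes of the cone
(`Tournament.IsDoublyRegular.coneSignMatrix_mul_transpose`).

If a matrix of rank `k = 2 (d - 1)` induces a tournament containing the cone, a submatrix factors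
as `U V` with inner dimension `k` and has the off-diagonal signs of `S`. Suppose that the rows
`uᵢ` of `U` can be weighted, and `ℝᵏ` transformed linearly, so that they become the rows of a
matrix `X` with orthonormal columns and with all rows of squared norm at most `L`. Let `Y` be `V`
after the inverse transformation, with columns scaled to unit length, and `Z = X Y`. The sum
`∑ Sᵢⱼ Zᵢⱼ` is at most `√((n - 1) k n)` by the Cauchy–Schwarz inequality, since `‖Sᵀ X‖² = (n - 1) k`
in the Frobenius norm, and at least `(n - n L) / √L`, since `|Zᵢⱼ| ≤ √L` and the columns of `Z`
are unit vectors; the term `n L` accounts for the diagonal (`sq_card_sub_le_of_isotropic`).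

Forster uses an exact radial isotropic position, with `L = k / n`. The constant `12` leaves room
for `L = 2 k / n`, and this is obtained without a compactness argument
(`exists_weights_leverage_le`). The potential `det (∑ cᵢ uᵢ uᵢᵀ) ^ n / (∏ cᵢ) ^ k` is bounded
below by a positive constant when the rows are in general position, which a small perturbation
achieves without changing off-diagonal signs; and halving a weight whose leverage score exceeds
`2 k / n` multiplies the potential by at most `2 / e`. Hence weights whose potential is close enough
to the infimum have all leverage scores at most `2 k / n`. The resulting inequality
`(n - 2 k) ^ 2 ≤ 2 k ^ 2 (n - 1)` fails for the values above.
-/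

section Forster

open Matrix

/-! ### Weighted Gram matrices -/

/-- The weighted Gram matrix `∑ᵢ cᵢ uᵢ uᵢᵀ` of the rows `uᵢ` of `U`. -/
def weightedGram {ι κ : Type*} [Fintype ι] (U : Matrix ι κ ℝ) (c : ι → ℝ) : Matrix κ κ ℝ :=
  ∑ i, c i • vecMulVec (U i) (U i)

theorem weightedGram_eq_mul {ι κ : Type*} [Fintype ι] [DecidableEq ι] (U : Matrix ι κ ℝ)
    (c : ι → ℝ) : weightedGram U c = Uᵀ * diagonal c * U := by
  ext a b
  simp only [weightedGram, Matrix.sum_apply, Matrix.smul_apply, vecMulVec_apply, smul_eq_mul,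
    Matrix.mul_apply (M := Uᵀ * diagonal c), mul_diagonal, transpose_apply]
  exact Finset.sum_congr rfl fun i _ => by ring

theorem posSemidef_smul_vecMulVec {κ : Type*} [Fintype κ] {t : ℝ} (ht : 0 ≤ t) (u : κ → ℝ) :
    (t • vecMulVec u u).PosSemidef := by
  have := (posSemidef_vecMulVec_self_star u).smul ht
  simpa using this

theorem det_add_smul_vecMulVec {κ : Type*} [Fintype κ] [DecidableEq κ] {A : Matrix κ κ ℝ}
    (hA : IsUnit A.det) (t : ℝ) (u : κ → ℝ) :
    (A + t • vecMulVec u u).det = A.det * (1 + t * (u ⬝ᵥ A⁻¹ *ᵥ u)) := by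
  have h := det_add_replicateCol_mul_replicateRow (ι := Unit) hA (t • u) u
  rw [← vecMulVec_eq, smul_vecMulVec] at h
  rw [h, det_unique (n := Unit), Matrix.add_apply, Matrix.one_apply_eq, Matrix.mul_assoc,
    ← replicateCol_mulVec, replicateRow_mul_replicateCol_apply, mulVec_smul, dotProduct_smul,
    smul_eq_mul]

theorem Matrix.PosDef.det_le_det_add_sum {ι κ : Type*} [Fintype κ] [DecidableEq κ]
    {A : Matrix κ κ ℝ} (hA : A.PosDef) (U : Matrix ι κ ℝ) {c : ι → ℝ} (hc : ∀ i, 0 ≤ c i)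
    (s : Finset ι) : A.det ≤ (A + ∑ i ∈ s, c i • vecMulVec (U i) (U i)).det := by
  classical
  induction s using Finset.induction_on with
  | empty => simp
  | insert i s his ih =>
    have hB : (A + ∑ i ∈ s, c i • vecMulVec (U i) (U i)).PosDef :=
      hA.add_posSemidef (posSemidef_sum s fun i _ => posSemidef_smul_vecMulVec (hc i) (U i))
    rw [Finset.sum_insert his, add_comm (c i • _), ← add_assoc,
      det_add_smul_vecMulVec hB.det_pos.ne'.isUnit]
    have h0 := hB.inv.posSemidef.dotProduct_mulVec_nonneg (U i)
    rw [star_trivial] at h0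
    exact ih.trans (le_mul_of_one_le_right hB.det_pos.le
      (le_add_of_nonneg_right (mul_nonneg (hc i) h0)))

/-- A weighted Gram matrix is bounded below by the part of it coming from the rows in a set `σ`
of the size of the dimension; when these rows are independent that part has determinant
`(∏ c_σ) (det U_σ)² > 0`. -/
theorem weightedGram_posDef_and_le_det {ι κ : Type*} [Fintype ι] [Fintype κ] [DecidableEq κ]
    (U : Matrix ι κ ℝ) {c : ι → ℝ} (hc : ∀ i, 0 < c i) (σ : κ ↪ ι)
    (hσ : (U.submatrix σ id).det ≠ 0) :
    (weightedGram U c).PosDef ∧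
      (∏ a, c (σ a)) * (U.submatrix σ id).det ^ 2 ≤ (weightedGram U c).det := by
  classical
  have hA : (weightedGram (U.submatrix σ id) (c ∘ σ)).PosDef := by
    rw [weightedGram_eq_mul]
    have h := (PosDef.diagonal (d := c ∘ σ) fun a => hc (σ a)).conjTranspose_mul_mul_same
      (B := U.submatrix σ id) (mulVec_injective_iff_isUnit.2
        ((isUnit_iff_isUnit_det _).2 hσ.isUnit))
    rwa [conjTranspose_eq_transpose_of_trivial] at h
  have hdet : (weightedGram (U.submatrix σ id) (c ∘ σ)).det
      = (∏ a, c (σ a)) * (U.submatrix σ id).det ^ 2 := by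
    rw [weightedGram_eq_mul, det_mul, det_mul, det_transpose, det_diagonal]
    simp only [Function.comp_apply]
    ring
  have hsplit : weightedGram U c = weightedGram (U.submatrix σ id) (c ∘ σ) +
      ∑ i ∈ (Finset.univ.map σ)ᶜ, c i • vecMulVec (U i) (U i) := by
    rw [weightedGram, ← Finset.sum_add_sum_compl (Finset.univ.map σ), Finset.sum_map]
    rfl
  rw [hsplit, ← hdet]
  exact ⟨hA.add_posSemidef (posSemidef_sum _ fun i _ =>
    posSemidef_smul_vecMulVec (hc i).le (U i)), hA.det_le_det_add_sum U (fun i => (hc i).le) _⟩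

/-! ### Weights with nearly uniform leverage scores -/

/-- Some `k` of the numbers `cᵢ` have geometric mean at least that of all of them. The proof
averages over the cyclic windows of length `k`. -/
theorem exists_embedding_prod_pow_le {ι : Type*} [Fintype ι] [Nonempty ι] {k : ℕ}
    (hk : k ≤ Fintype.card ι) {c : ι → ℝ} (hc : ∀ i, 0 < c i) :
    ∃ σ : Fin k ↪ ι, (∏ i, c i) ^ k ≤ (∏ a, c (σ a)) ^ Fintype.card ι := by
  obtain ⟨n, hn⟩ : ∃ n, Fintype.card ι = n := ⟨_, rfl⟩
  rw [hn] at hk ⊢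
  have : NeZero n := ⟨hn ▸ Fintype.card_ne_zero⟩
  let e : Fin n ≃ ι := (Fintype.equivFinOfCardEq hn).symm
  let w : Fin n → Fin k ↪ ι := fun r =>
    ((Fin.castLEEmb hk).trans (Equiv.addLeft r).toEmbedding).trans e.toEmbedding
  obtain ⟨r, -, hr⟩ := Finset.exists_max_image Finset.univ (fun r => ∏ a, c (w r a))
    Finset.univ_nonempty
  refine ⟨w r, ?_⟩
  calc (∏ i, c i) ^ k = ∏ a : Fin k, ∏ s : Fin n, c (w s a) := by
        have h : ∀ a : Fin k, ∏ s : Fin n, c (w s a) = ∏ i, c i := fun a =>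
          Fintype.prod_equiv ((Equiv.addRight (Fin.castLE hk a)).trans e) _ _ fun s => rfl
        simp [h]
    _ = ∏ s : Fin n, ∏ a : Fin k, c (w s a) := Finset.prod_comm
    _ ≤ ∏ _s : Fin n, ∏ a : Fin k, c (w r a) :=
        Finset.prod_le_prod (fun s _ => Finset.prod_nonneg fun a _ => (hc _).le)
          fun s _ => hr s (Finset.mem_univ s)
    _ = (∏ a, c (w r a)) ^ n := by simp

/-- Forster's potential `det (∑ᵢ cᵢ uᵢ uᵢᵀ) ^ n / (∏ᵢ cᵢ) ^ k`, which is invariant under rescaling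
of `c` and whose critical points are the weights with all leverage scores equal to `k / n`. -/
noncomputable def forsterPotential {ι : Type*} [Fintype ι] {k : ℕ} (U : Matrix ι (Fin k) ℝ)
    (c : ι → ℝ) : ℝ :=
  (weightedGram U c).det ^ Fintype.card ι / (∏ i, c i) ^ k

theorem exists_pos_le_forsterPotential {ι : Type*} [Fintype ι] [Nonempty ι] {k : ℕ}
    (hk : k ≤ Fintype.card ι) (U : Matrix ι (Fin k) ℝ)
    (hU : ∀ σ : Fin k ↪ ι, (U.submatrix σ id).det ≠ 0) :
    ∃ m : ℝ, 0 < m ∧ ∀ c : ι → ℝ, (∀ i, 0 < c i) → m ≤ forsterPotential U c := by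
  classical
  obtain ⟨σ₁, -⟩ := exists_embedding_prod_pow_le hk (c := fun _ : ι => (1 : ℝ))
    fun _ => one_pos
  obtain ⟨σ₀, -, h₀⟩ := Finset.exists_min_image (Finset.univ : Finset (Fin k ↪ ι))
    (fun σ => (U.submatrix σ id).det ^ 2) ⟨σ₁, Finset.mem_univ _⟩
  have hm : 0 < (U.submatrix σ₀ id).det ^ 2 := by
    have := hU σ₀
    positivity
  refine ⟨((U.submatrix σ₀ id).det ^ 2) ^ Fintype.card ι, pow_pos hm _, fun c hc => ?_⟩
  obtain ⟨σ, hσ⟩ := exists_embedding_prod_pow_le hk hc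
  have hcσ : 0 < ∏ a, c (σ a) := Finset.prod_pos fun a _ => hc _
  have hP : 0 < (∏ i, c i) ^ k := pow_pos (Finset.prod_pos fun i _ => hc i) k
  rw [forsterPotential, le_div_iff₀ hP]
  calc ((U.submatrix σ₀ id).det ^ 2) ^ Fintype.card ι * (∏ i, c i) ^ k
      ≤ ((U.submatrix σ id).det ^ 2) ^ Fintype.card ι * (∏ a, c (σ a)) ^ Fintype.card ι := by
        gcongr ?_ ^ _ * ?_
        exact h₀ σ (Finset.mem_univ σ)
    _ = ((∏ a, c (σ a)) * (U.submatrix σ id).det ^ 2) ^ Fintype.card ι := by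
        rw [← mul_pow, mul_comm]
    _ ≤ _ := by
        gcongr
        exact (weightedGram_posDef_and_le_det U hc σ (hU σ)).2

theorem one_sub_half_pow_mul_two_pow_le {n k : ℕ} (hk : 0 < k) (hkn : k ≤ n) {l : ℝ}
    (hl : 2 * k / n < l) (hl' : 0 ≤ 1 - l / 2) :
    (1 - l / 2) ^ n * 2 ^ k ≤ 3 / 4 := by
  have hkR : (1 : ℝ) ≤ k := by exact_mod_cast hk
  have h1 : (1 - l / 2) ^ n ≤ Real.exp (-k) := by
    refine le_trans ?_ (Real.one_sub_div_pow_le_exp_neg (n := n) (by exact_mod_cast hkn))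
    exact pow_le_pow_left₀ hl' (by linarith [mul_div_assoc (2 : ℝ) k n]) n
  have h2 : Real.exp (-k) * 2 ^ k = (Real.exp (-1) * 2) ^ k := by
    rw [mul_pow, ← Real.exp_nat_mul]
    ring_nf
  have h3 : Real.exp (-1) * 2 ≤ 3 / 4 := by
    rw [Real.exp_neg, inv_mul_le_iff₀ (Real.exp_pos 1)]
    linarith [Real.exp_one_gt_d9]
  calc (1 - l / 2) ^ n * 2 ^ k ≤ Real.exp (-k) * 2 ^ k := by gcongr
    _ = (Real.exp (-1) * 2) ^ k := h2
    _ ≤ Real.exp (-1) * 2 := pow_le_of_le_one (by positivity) (h3.trans (by norm_num)) hk.ne'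
    _ ≤ 3 / 4 := h3

/-- Approximate radial isotropy: rows in general position can be weighted so that every leverage
score is at most twice the average `k / n`. If a leverage score exceeds `2k / n`, halving its
weight decreases Forster's potential by a constant factor, so weights whose potential is close to
the infimum have the property. -/
theorem exists_weights_leverage_le {ι : Type*} [Fintype ι] [Nonempty ι] {k : ℕ} (hk : 0 < k)
    (hkn : k ≤ Fintype.card ι) (U : Matrix ι (Fin k) ℝ)
    (hU : ∀ σ : Fin k ↪ ι, (U.submatrix σ id).det ≠ 0) :
    ∃ c : ι → ℝ, (∀ i, 0 < c i) ∧ (weightedGram U c).PosDef ∧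
      ∀ i, c i * (U i ⬝ᵥ (weightedGram U c)⁻¹ *ᵥ U i) ≤ 2 * k / Fintype.card ι := by
  classical
  obtain ⟨m, hm, hmle⟩ := exists_pos_le_forsterPotential hkn U hU
  obtain ⟨σ, -⟩ := exists_embedding_prod_pow_le hkn (c := fun _ : ι => (1 : ℝ)) fun _ => one_pos
  let Φ : Set ℝ := forsterPotential U '' {c | ∀ i, 0 < c i}
  have hΦ : Φ.Nonempty := ⟨_, fun _ => 1, fun _ => one_pos, rfl⟩
  have hb : BddBelow Φ := ⟨m, by rintro _ ⟨c, hc, rfl⟩; exact hmle c hc⟩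
  have hI : 0 < sInf Φ := hm.trans_le (le_csInf hΦ (by rintro _ ⟨c, hc, rfl⟩; exact hmle c hc))
  -- Halving a weight with a large leverage score multiplies the potential by at most `3 / 4`,
  -- which is impossible within a factor `4 / 3` of the infimum.
  obtain ⟨_, ⟨c, hc, rfl⟩, hclt⟩ := exists_lt_of_csInf_lt hΦ
    (show sInf Φ < 4 / 3 * sInf Φ by linarith)
  have hpd : ∀ c : ι → ℝ, (∀ i, 0 < c i) → (weightedGram U c).PosDef := fun c hc =>
    (weightedGram_posDef_and_le_det U hc σ (hU σ)).1
  refine ⟨c, hc, hpd c hc, fun i => ?_⟩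
  by_contra! hl
  set l := c i * (U i ⬝ᵥ (weightedGram U c)⁻¹ *ᵥ U i) with hldef
  let c' : ι → ℝ := Function.update c i (c i / 2)
  have hc' : ∀ j, 0 < c' j := fun j => by
    rcases eq_or_ne j i with rfl | h
    · simpa [c'] using hc j
    · simpa [c', h] using hc j
  have hgram : weightedGram U c' = weightedGram U c + (-(c i / 2)) • vecMulVec (U i) (U i) := by
    rw [weightedGram, weightedGram, ← Finset.add_sum_erase _ _ (Finset.mem_univ i),
      ← Finset.add_sum_erase (a := i) Finset.univ (fun i => c i • vecMulVec (U i) (U i))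
        (Finset.mem_univ i),
      Finset.sum_congr rfl (g := fun j => c j • vecMulVec (U j) (U j)) fun j hj => by
        simp [c', Finset.ne_of_mem_erase hj]]
    rw [show c' i = c i + -(c i / 2) by simp [c']; ring, add_smul]
    abel
  have hdet : (weightedGram U c').det = (weightedGram U c).det * (1 - l / 2) := by
    rw [hgram, det_add_smul_vecMulVec (hpd c hc).det_pos.ne'.isUnit, hldef]
    ring
  have hprod : ∏ j, c' j = (∏ j, c j) / 2 := by
    rw [← Finset.mul_prod_erase _ _ (Finset.mem_univ i),
      ← Finset.mul_prod_erase (a := i) Finset.univ c (Finset.mem_univ i),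
      Finset.prod_congr rfl (g := c) fun j hj => by simp [c', Finset.ne_of_mem_erase hj]]
    simp only [c', Function.update_self]
    ring
  have hl' : 0 ≤ 1 - l / 2 := by
    have := (hpd c' hc').det_pos
    rw [hdet] at this
    exact (pos_of_mul_pos_right this (hpd c hc).det_pos.le).le
  have hpot : forsterPotential U c' =
      forsterPotential U c * ((1 - l / 2) ^ Fintype.card ι * 2 ^ k) := by
    rw [forsterPotential, forsterPotential, hdet, hprod, mul_pow, div_pow]
    field_simp
  have hle : sInf Φ ≤ forsterPotential U c' := csInf_le hb ⟨c', hc', rfl⟩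
  have h34 := one_sub_half_pow_mul_two_pow_le hk hkn hl hl'
  have hpos : 0 < forsterPotential U c := hm.trans_le (hmle c hc)
  rw [hpot] at hle
  nlinarith [mul_le_mul_of_nonneg_left h34 hpos.le]

/-! ### General position -/

/-- Adding small multiples of a Vandermonde matrix puts the rows of any matrix in general
position. -/
theorem exists_eventually_det_submatrix_ne_zero (ι : Type*) [Finite ι] (k : ℕ) :
    ∃ G : Matrix ι (Fin k) ℝ, ∀ U : Matrix ι (Fin k) ℝ, ∀ᶠ ε in nhdsWithin (0 : ℝ) {0}ᶜ,
      ∀ σ : Fin k ↪ ι, ((U + ε • G).submatrix σ id).det ≠ 0 := by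
  have := Fintype.ofFinite ι
  let x : ι → ℝ := fun i => ((Fintype.equivFin ι i : ℕ) : ℝ)
  have hx : Function.Injective x :=
    Nat.cast_injective.comp (Fin.val_injective.comp (Fintype.equivFin ι).injective)
  refine ⟨of fun i a => x i ^ (a : ℕ), fun U => ?_⟩
  rw [Filter.eventually_all]
  intro σ
  set G : Matrix ι (Fin k) ℝ := of fun i a => x i ^ (a : ℕ)
  have hdetG : (G.submatrix σ id).det ≠ 0 :=
    det_vandermonde_ne_zero_iff.2 (hx.comp σ.injective)
  -- The determinant is a polynomial in `ε` whose coefficient of degree `k` is the Vandermonde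
  -- determinant, so it has finitely many roots.
  let p : Polynomial ℝ := ((Polynomial.X : Polynomial ℝ) • (G.submatrix σ id).map Polynomial.C +
    (U.submatrix σ id).map Polynomial.C).det
  have hp : p ≠ 0 := by
    intro h0
    apply hdetG
    rw [← Polynomial.coeff_det_X_add_C_card (G.submatrix σ id) (U.submatrix σ id)]
    change p.coeff _ = 0
    rw [h0, Polynomial.coeff_zero]
  have hev : ∀ ε : ℝ, p.eval ε = ((U + ε • G).submatrix σ id).det := fun ε => by
    rw [← Polynomial.coe_evalRingHom, RingHom.map_det]
    congr 1
    ext a b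
    simp [add_comm, mul_comm (G _ _) ε]
  have hfin : (p.roots.toFinset : Set ℝ).Finite := p.roots.toFinset.finite_toSet
  have hc : ∀ᶠ ε in nhdsWithin (0 : ℝ) {0}ᶜ, ε ∉ (p.roots.toFinset : Set ℝ) \ {0} :=
    Filter.Eventually.filter_mono nhdsWithin_le_nhds <|
      (hfin.subset Set.sdiff_subset).isClosed.isOpen_compl.mem_nhds fun h => h.2 rfl
  filter_upwards [hc, self_mem_nhdsWithin] with ε h1 h2 h3
  refine h1 ⟨?_, h2⟩
  simp [hp, hev, h3]

/-! ### Forster's inequality -/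

/-- The trace estimate: if `X` has orthonormal columns and all rows of squared norm at most `L`,
`Y` has unit columns, and `X * Y` has off-diagonal signs given by a matrix `S` which is `√q` times
an orthogonal matrix, then bounding `∑ Sᵢⱼ (X Y)ᵢⱼ` from both sides gives the inequality. -/
theorem sq_card_sub_le_of_isotropic {ι κ : Type*} [Fintype ι] [Fintype κ] [DecidableEq ι]
    [DecidableEq κ] {S : Matrix ι ι ℝ} {q L : ℝ} (hS : S * Sᵀ = q • 1)
    (hSabs : ∀ i j, i ≠ j → |S i j| = 1) (hSdiag : ∀ i, S i i = 0)
    {X : Matrix ι κ ℝ} {Y : Matrix κ ι ℝ} (hX : Xᵀ * X = 1) (hXL : ∀ i, (X * Xᵀ) i i ≤ L)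
    (hL0 : 0 ≤ L) (hL1 : L ≤ 1) (hY : ∀ j, (Yᵀ * Y) j j = 1)
    (hsign : ∀ i j, i ≠ j → 0 < S i j * (X * Y) i j) :
    (Fintype.card ι - Fintype.card ι * L) ^ 2
      ≤ L * (q * Fintype.card κ * Fintype.card ι) := by
  set Z := X * Y with hZ
  set n : ℝ := (Fintype.card ι : ℝ)
  have hZL : ∀ i j, Z i j ^ 2 ≤ L := fun i j => by
    have h1 := Finset.sum_mul_sq_le_sq_mul_sq Finset.univ (fun a => X i a) (fun a => Y a j)
    have h2 : ∑ a, X i a ^ 2 ≤ L := by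
      simpa [Matrix.mul_apply, sq] using hXL i
    have h3 : ∑ a, Y a j ^ 2 = 1 := by
      simpa [Matrix.mul_apply, sq] using hY j
    rw [h3, mul_one] at h1
    exact h1.trans h2
  have hterm : ∀ i j, Z i j ^ 2 ≤ √L * (S i j * Z i j) + if i = j then L else 0 := fun i j => by
    by_cases hij : i = j
    · subst hij
      simpa [hSdiag i] using hZL i i
    · have h1 : S i j * Z i j = |Z i j| := by
        rw [← abs_of_pos (hsign i j hij), abs_mul, hSabs i j hij, one_mul]
      rw [if_neg hij, add_zero, h1, ← sq_abs, sq]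
      exact mul_le_mul_of_nonneg_right (Real.abs_le_sqrt (hZL i j)) (abs_nonneg _)
  have hcol : ∀ j, ∑ i, Z i j ^ 2 = 1 := fun j => by
    have h1 : Zᵀ * Z = Yᵀ * Y := by
      rw [hZ, transpose_mul, Matrix.mul_assoc, ← Matrix.mul_assoc Xᵀ, hX, Matrix.one_mul]
    have h2 := hY j
    rw [← h1] at h2
    simpa [Matrix.mul_apply, sq] using h2
  set T := ∑ j, ∑ i, S i j * Z i j with hT
  have hlower : n - n * L ≤ √L * T := by
    have h : ∑ j, ∑ i, Z i j ^ 2 ≤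
        ∑ j, ∑ i, (√L * (S i j * Z i j) + if i = j then L else 0) :=
      Finset.sum_le_sum fun j _ => Finset.sum_le_sum fun i _ => hterm i j
    simp only [hcol, Finset.sum_add_distrib, ← Finset.mul_sum, Finset.sum_ite_eq',
      Finset.mem_univ, if_true, Finset.sum_const, Finset.card_univ, nsmul_eq_mul, mul_one] at h
    linarith
  have hupper : T ^ 2 ≤ q * Fintype.card κ * n := by
    have h1 : T = ∑ p : ι × κ, (Sᵀ * X) p.1 p.2 * Y p.2 p.1 := by
      rw [Fintype.sum_prod_type, hT]
      refine Finset.sum_congr rfl fun j _ => ?_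
      calc ∑ i, S i j * Z i j = (Sᵀ * Z) j j := by simp [Matrix.mul_apply]
        _ = ((Sᵀ * X) * Y) j j := by rw [hZ, Matrix.mul_assoc]
        _ = _ := Matrix.mul_apply
    have h2 : ∑ p : ι × κ, (Sᵀ * X) p.1 p.2 ^ 2 = q * Fintype.card κ := by
      have h3 : (Sᵀ * X)ᵀ * (Sᵀ * X) = q • 1 := by
        rw [transpose_mul, transpose_transpose, Matrix.mul_assoc, ← Matrix.mul_assoc S, hS,
          smul_mul, Matrix.one_mul, Matrix.mul_smul, hX]
      have h4 := congrArg trace h3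
      rw [trace_smul, trace_one] at h4
      rw [Fintype.sum_prod_type_right, ← smul_eq_mul, ← h4]
      simp only [trace, diag_apply, Matrix.mul_apply (M := (Sᵀ * X)ᵀ), transpose_apply, sq]
    have h5 : ∑ p : ι × κ, Y p.2 p.1 ^ 2 = n := by
      rw [Fintype.sum_prod_type]
      have : ∀ j, ∑ a, Y a j ^ 2 = 1 := fun j => by simpa [Matrix.mul_apply, sq] using hY j
      simp [this, n]
    rw [h1, ← h2, ← h5]
    exact Finset.sum_mul_sq_le_sq_mul_sq _ _ _
  calc (n - n * L) ^ 2 ≤ (√L * T) ^ 2 := by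
        refine pow_le_pow_left₀ ?_ hlower 2
        nlinarith [Nat.cast_nonneg (α := ℝ) (Fintype.card ι)]
    _ = L * T ^ 2 := by rw [mul_pow, Real.sq_sqrt hL0]
    _ ≤ _ := mul_le_mul_of_nonneg_left hupper hL0

/-- Forster's inequality, with a constant lost to the approximate radial isotropy, for a product
whose left factor has rows in general position. -/
theorem sq_card_sub_le_of_generalPosition {ι : Type*} [Fintype ι] [DecidableEq ι] [Nontrivial ι]
    {k : ℕ} (hk : 0 < k) (hkn : 2 * k ≤ Fintype.card ι) {S : Matrix ι ι ℝ} {q : ℝ}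
    (hS : S * Sᵀ = q • 1) (hSabs : ∀ i j, i ≠ j → |S i j| = 1) (hSdiag : ∀ i, S i i = 0)
    {U : Matrix ι (Fin k) ℝ} (hU : ∀ σ : Fin k ↪ ι, (U.submatrix σ id).det ≠ 0)
    {V : Matrix (Fin k) ι ℝ} (hsign : ∀ i j, i ≠ j → 0 < S i j * (U * V) i j) :
    ((Fintype.card ι : ℝ) - 2 * k) ^ 2 ≤ 2 * k ^ 2 * q := by
  have hn : (0 : ℝ) < Fintype.card ι := by exact_mod_cast Fintype.card_pos
  obtain ⟨c, hc, hpd, hlev⟩ := exists_weights_leverage_le hk (by omega) U hU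
  obtain ⟨B, hB⟩ : ∃ B : Matrix (Fin k) (Fin k) ℝ, weightedGram U c = Bᵀ * B := by
    open scoped MatrixOrder in
    obtain ⟨B, hB⟩ := CStarAlgebra.nonneg_iff_eq_star_mul_self.1 hpd.posSemidef.nonneg
    exact ⟨B, by rw [hB, star_eq_conjTranspose, conjTranspose_eq_transpose_of_trivial]⟩
  have hBdet : IsUnit B.det := by
    have h := hpd.det_pos
    rw [hB, det_mul, det_transpose] at h
    exact (ne_of_gt (mul_self_pos.1 h |> fun h => abs_pos.2 h) |> abs_ne_zero.1).isUnit
  let D : Matrix ι ι ℝ := diagonal fun i => √(c i)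
  have hDD : D * D = diagonal c := by
    rw [diagonal_mul_diagonal]
    exact congrArg diagonal (funext fun i => Real.mul_self_sqrt (hc i).le)
  let X : Matrix ι (Fin k) ℝ := D * U * B⁻¹
  have hX : Xᵀ * X = 1 := by
    calc Xᵀ * X = (B⁻¹)ᵀ * (Uᵀ * (D * D) * U) * B⁻¹ := by
          simp only [X, D, transpose_mul, diagonal_transpose, Matrix.mul_assoc]
      _ = (B⁻¹)ᵀ * (Bᵀ * B) * B⁻¹ := by rw [hDD, ← weightedGram_eq_mul, hB]
      _ = (B * B⁻¹)ᵀ * (B * B⁻¹) := by simp only [transpose_mul, Matrix.mul_assoc]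
      _ = 1 := by rw [mul_nonsing_inv _ hBdet, transpose_one, Matrix.one_mul]
  have hXL : ∀ i, (X * Xᵀ) i i ≤ 2 * k / Fintype.card ι := fun i => by
    have h1 : X * Xᵀ = D * (U * (weightedGram U c)⁻¹ * Uᵀ) * D := by
      simp only [X, D, hB, Matrix.mul_inv_rev, transpose_mul, diagonal_transpose,
        Matrix.mul_assoc, transpose_nonsing_inv]
    have h2 : (U * (weightedGram U c)⁻¹ * Uᵀ) i i = U i ⬝ᵥ (weightedGram U c)⁻¹ *ᵥ U i := by
      rw [Matrix.mul_assoc]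
      rfl
    rw [h1, mul_diagonal, diagonal_mul, h2, mul_right_comm, Real.mul_self_sqrt (hc i).le]
    exact hlev i
  let v : ι → Fin k → ℝ := fun j a => (B * V) a j
  have hv : ∀ j, 0 < v j ⬝ᵥ v j := fun j => by
    refine lt_of_le_of_ne (by simpa using dotProduct_star_self_nonneg (v j)) fun h0 => ?_
    have hv0 : v j = 0 := dotProduct_self_eq_zero.1 h0.symm
    obtain ⟨i, hi⟩ := exists_ne j
    have h1 : (U * V) i j = 0 := by
      have h2 : U * V = U * B⁻¹ * (B * V) := by
        rw [Matrix.mul_assoc, ← Matrix.mul_assoc B⁻¹, nonsing_inv_mul _ hBdet, Matrix.one_mul]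
      rw [h2, Matrix.mul_apply]
      exact Finset.sum_eq_zero fun a _ => by rw [show (B * V) a j = 0 from congrFun hv0 a, mul_zero]
    have := hsign i j hi
    rw [h1, mul_zero] at this
    exact this.false
  let Y : Matrix (Fin k) ι ℝ := B * V * diagonal fun j => (√(v j ⬝ᵥ v j))⁻¹
  have hY : ∀ j, (Yᵀ * Y) j j = 1 := fun j => by
    have h1 : ∀ a, Y a j = v j a * (√(v j ⬝ᵥ v j))⁻¹ := fun a => by simp [Y, v, mul_diagonal]
    have h2 : (Yᵀ * Y) j j = (v j ⬝ᵥ v j) * ((√(v j ⬝ᵥ v j))⁻¹ * (√(v j ⬝ᵥ v j))⁻¹) := by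
      simp only [Matrix.mul_apply (M := Yᵀ), transpose_apply, h1]
      rw [dotProduct, Finset.sum_mul]
      exact Finset.sum_congr rfl fun a _ => by ring
    rw [h2, ← mul_inv, Real.mul_self_sqrt (hv j).le, mul_inv_cancel₀ (hv j).ne']
  have hXY : ∀ i j, (X * Y) i j = √(c i) * (U * V) i j * (√(v j ⬝ᵥ v j))⁻¹ := fun i j => by
    have h1 : X * Y = D * (U * V) * diagonal fun j => (√(v j ⬝ᵥ v j))⁻¹ := by
      calc X * Y = D * U * (B⁻¹ * B) * V * diagonal fun j => (√(v j ⬝ᵥ v j))⁻¹ := by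
            simp only [X, Y, Matrix.mul_assoc]
        _ = _ := by rw [nonsing_inv_mul _ hBdet, Matrix.mul_one, Matrix.mul_assoc D]
    rw [h1, mul_diagonal, diagonal_mul]
  have hL1 : (2 * k / Fintype.card ι : ℝ) ≤ 1 := by
    rw [div_le_one hn]
    exact_mod_cast hkn
  have key := sq_card_sub_le_of_isotropic hS hSabs hSdiag hX hXL (by positivity) hL1 hY
    fun i j hij => by
      rw [hXY]
      have h1 := hsign i j hij
      have h2 := Real.sqrt_pos.2 (hc i)
      have h3 := inv_pos.2 (Real.sqrt_pos.2 (hv j))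
      calc 0 < √(c i) * (S i j * (U * V) i j) * (√(v j ⬝ᵥ v j))⁻¹ := by positivity
        _ = _ := by ring
  rw [Fintype.card_fin] at key
  calc ((Fintype.card ι : ℝ) - 2 * k) ^ 2
      = (Fintype.card ι - Fintype.card ι * (2 * k / Fintype.card ι)) ^ 2 := by
        rw [mul_div_cancel₀ _ hn.ne']
    _ ≤ _ := key
    _ = 2 * k ^ 2 * q := by field_simp

/-- The same inequality for an arbitrary product of inner dimension `k`: the sign conditions are
open, so the left factor can be moved into general position. -/
theorem sq_card_sub_le_of_sign {ι : Type*} [Fintype ι] [DecidableEq ι] [Nontrivial ι]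
    {k : ℕ} (hkn : 2 * k ≤ Fintype.card ι) {S : Matrix ι ι ℝ} {q : ℝ}
    (hS : S * Sᵀ = q • 1) (hSabs : ∀ i j, i ≠ j → |S i j| = 1) (hSdiag : ∀ i, S i i = 0)
    {U : Matrix ι (Fin k) ℝ} {V : Matrix (Fin k) ι ℝ}
    (hsign : ∀ i j, i ≠ j → 0 < S i j * (U * V) i j) :
    ((Fintype.card ι : ℝ) - 2 * k) ^ 2 ≤ 2 * k ^ 2 * q := by
  rcases Nat.eq_zero_or_pos k with rfl | hk
  · obtain ⟨i, j, hij⟩ := exists_pair_ne ι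
    have := hsign i j hij
    simp [Matrix.mul_apply] at this
  obtain ⟨G, hG⟩ := exists_eventually_det_submatrix_ne_zero ι k
  have hev : ∀ᶠ ε in nhdsWithin (0 : ℝ) {0}ᶜ, ∀ i j, i ≠ j →
      0 < S i j * ((U + ε • G) * V) i j := by
    refine Filter.Eventually.filter_mono nhdsWithin_le_nhds ?_
    simp only [Filter.eventually_all]
    intro i j hij
    have hcont : Continuous fun ε : ℝ => S i j * ((U + ε • G) * V) i j := by
      simp only [Matrix.mul_apply, Matrix.add_apply, Matrix.smul_apply, smul_eq_mul]
      fun_prop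
    refine hcont.continuousAt.eventually_mem (isOpen_Ioi.mem_nhds ?_)
    simpa using hsign i j hij
  obtain ⟨ε, h1, h2⟩ := ((hG U).and hev).exists
  exact sq_card_sub_le_of_generalPosition hk hkn hS hSabs hSdiag h1 h2

theorem Matrix.exists_eq_mul_of_rank {m n : Type*} [Fintype m] [Fintype n] [DecidableEq n]
    (M : Matrix m n ℝ) :
    ∃ (U : Matrix m (Fin M.rank) ℝ) (V : Matrix (Fin M.rank) n ℝ), M = U * V := by
  let b := Module.finBasisOfFinrankEq ℝ (LinearMap.range M.mulVecLin) (n := M.rank) rfl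
  let w : n → LinearMap.range M.mulVecLin := fun j => ⟨M.mulVecLin (Pi.single j 1), _, rfl⟩
  refine ⟨of fun i a => (b a : m → ℝ) i, of fun a j => b.repr (w j) a, ?_⟩
  ext i j
  have h := congrFun (congrArg Subtype.val (b.sum_repr (w j))) i
  simp only [w, mulVecLin_apply, mulVec_single_one, col_apply] at h
  rw [← h]
  simp only [Submodule.coe_sum, Submodule.coe_smul, Finset.sum_apply, Pi.smul_apply, smul_eq_mul,
    Matrix.mul_apply, of_apply]
  refine Finset.sum_congr rfl fun a _ => ?_
  rw [mul_comm]
  simp [w]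

end Forster

section Cone

open Matrix

/-! ### The sign matrix of a cone over a doubly regular tournament -/

namespace Tournament

open scoped Classical in
/-- The real `0`-`1` adjacency matrix of a tournament. -/
noncomputable def adjMatrix {V : Type*} (R : Tournament V) : Matrix V V ℝ :=
  of fun i j => if R.Adj i j then 1 else 0

theorem adjMatrix_apply_self {V : Type*} (R : Tournament V) (i : V) : R.adjMatrix i i = 0 := by
  have : ¬ R.Adj i i := fun h => R.asymm i i h h
  simp [adjMatrix, this]

theorem adjMatrix_add_swap {V : Type*} (R : Tournament V) {i j : V} (h : i ≠ j) :
    R.adjMatrix i j + R.adjMatrix j i = 1 := by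
  rcases R.total i j h with h1 | h1 <;> have h2 := R.asymm _ _ h1 <;> simp [adjMatrix, h1, h2]

theorem sum_adjMatrix {V : Type*} [Fintype V] (R : Tournament V) (i : V) :
    ∑ j, R.adjMatrix i j = (R.outNbrs i).ncard := by
  classical
  rw [Set.ncard_eq_toFinset_card']
  simp only [adjMatrix, of_apply, Finset.sum_boole]
  congr 2
  ext
  rw [Finset.mem_filter_univ, Set.mem_toFinset, outNbrs, Set.mem_ofPred_eq]

theorem sum_adjMatrix_mul {V : Type*} [Fintype V] (R : Tournament V) (i j : V) :
    ∑ k, R.adjMatrix i k * R.adjMatrix j k = (R.outNbrs i ∩ R.outNbrs j).ncard := by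
  classical
  rw [Set.ncard_eq_toFinset_card']
  simp only [adjMatrix, of_apply, ← ite_and, mul_ite, mul_one, mul_zero]
  rw [Finset.sum_boole]
  congr 2
  ext
  rw [Finset.mem_filter_univ, Set.mem_toFinset, and_comm]
  rfl

theorem sum_adjMatrix_add_sum_swap {V : Type*} [Fintype V] (R : Tournament V) (i : V) :
    ∑ j, R.adjMatrix i j + ∑ j, R.adjMatrix j i = Fintype.card V - 1 := by
  classical
  have h : ∀ j, R.adjMatrix i j + R.adjMatrix j i = 1 - if i = j then 1 else 0 := fun j => by
    by_cases hij : i = j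
    · subst hij; simp [adjMatrix_apply_self]
    · simp [adjMatrix_add_swap R hij, hij]
  rw [← Finset.sum_add_distrib]
  simp [h]

/-- The parameters of a doubly regular tournament on `m` nodes: out-degrees and in-degrees are
`(m - 1) / 2`, and two nodes have `(m - 3) / 4` common out-neighbours. -/
theorem IsDoublyRegular.exists_parameters {V : Type*} [Fintype V] [Nontrivial V]
    {R : Tournament V} (hR : R.IsDoublyRegular) :
    ∃ r l : ℝ, (Fintype.card V : ℝ) = 2 * r + 1 ∧ r = 2 * l + 1 ∧
      (∀ i, ∑ j, R.adjMatrix i j = r) ∧ (∀ i, ∑ j, R.adjMatrix j i = r) ∧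
      ∀ i j, i ≠ j → ∑ k, R.adjMatrix i k * R.adjMatrix j k = l := by
  classical
  obtain ⟨hdeg, l, hl⟩ := hR
  obtain ⟨i₀⟩ : Nonempty V := inferInstance
  set r : ℝ := ((R.outNbrs i₀).ncard : ℝ) with hr
  set m : ℝ := (Fintype.card V : ℝ) with hm
  have hm1 : 1 < m := by
    rw [hm]
    exact_mod_cast Fintype.one_lt_card
  have hout : ∀ i, ∑ j, R.adjMatrix i j = r := fun i => by rw [sum_adjMatrix, hdeg i i₀]
  have hin : ∀ i, ∑ j, R.adjMatrix j i = m - 1 - r := fun i => by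
    linarith [sum_adjMatrix_add_sum_swap R i, hout i]
  have hcommon : ∀ i j, i ≠ j → ∑ k, R.adjMatrix i k * R.adjMatrix j k = (l : ℝ) :=
    fun i j hij => by rw [sum_adjMatrix_mul, hl i j hij]
  -- Counting all edges by their tails and by their heads determines the degree.
  have hm2 : m = 2 * r + 1 := by
    have h : ∑ i, ∑ j, R.adjMatrix i j = ∑ j, ∑ i, R.adjMatrix i j := Finset.sum_comm
    simp only [hout, hin, Finset.sum_const, Finset.card_univ, nsmul_eq_mul] at h
    have := mul_left_cancel₀ (by linarith : m ≠ 0) h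
    linarith
  -- Counting the pairs `i₀ → k ← j` by `j` and by `k` determines the number of common
  -- out-neighbours.
  have hrl : r = 2 * l + 1 := by
    have h : ∑ j, ∑ k, R.adjMatrix i₀ k * R.adjMatrix j k
        = ∑ k, ∑ j, R.adjMatrix i₀ k * R.adjMatrix j k := Finset.sum_comm
    have hself : ∑ k, R.adjMatrix i₀ k * R.adjMatrix i₀ k = r := by
      rw [← hout i₀]
      exact Finset.sum_congr rfl fun k _ => by simp [adjMatrix]
    have hrow : ∀ j, ∑ k, R.adjMatrix i₀ k * R.adjMatrix j k
        = l + if i₀ = j then r - l else 0 := fun j => by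
      by_cases hj : i₀ = j
      · subst hj; simp [hself]
      · simp [hcommon i₀ j hj, hj]
    simp only [← Finset.mul_sum, hrow, hin, ← Finset.sum_mul, hout, Finset.sum_add_distrib,
      Finset.sum_const, Finset.card_univ, nsmul_eq_mul, Finset.sum_ite_eq, Finset.mem_univ,
      if_true] at h
    rw [← hm, hm2] at h
    have hr0 : r ≠ 0 := by linarith
    apply mul_left_cancel₀ hr0
    linarith
  exact ⟨r, l, hm2, hrl, hout, fun i => by rw [hin, hm2]; ring, hcommon⟩

/-- The skew sign matrix of the cone over `R` whose apex is `none`: the apex beats all other nodes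
if `s = 1`, and loses to all of them if `s = -1`. -/
noncomputable def coneSignMatrix {V : Type*} (R : Tournament V) (s : ℝ) :
    Matrix (Option V) (Option V) ℝ :=
  of fun x y => match x, y with
    | none, none => 0
    | none, some _ => s
    | some _, none => -s
    | some i, some j => R.adjMatrix i j - R.adjMatrix j i

theorem coneSignMatrix_diag {V : Type*} (R : Tournament V) (s : ℝ) (x : Option V) :
    R.coneSignMatrix s x x = 0 := by
  cases x <;> simp [coneSignMatrix]

theorem abs_coneSignMatrix {V : Type*} (R : Tournament V) {s : ℝ} (hs : |s| = 1)
    {x y : Option V} (h : x ≠ y) : |R.coneSignMatrix s x y| = 1 := by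
  match x, y with
  | none, none => exact absurd rfl h
  | none, some j => simpa [coneSignMatrix] using hs
  | some i, none => simpa [coneSignMatrix] using hs
  | some i, some j =>
    rcases R.total i j fun e => h (congrArg some e) with h1 | h1 <;>
      have h2 := R.asymm _ _ h1 <;> simp [coneSignMatrix, adjMatrix, h1, h2]

/-- The sign matrix of a cone over a doubly regular tournament is a skew conference matrix. -/
theorem IsDoublyRegular.coneSignMatrix_mul_transpose {V : Type*} [Fintype V] [DecidableEq V]
    [Nontrivial V] {R : Tournament V} (hR : R.IsDoublyRegular) {s : ℝ} (hs : |s| = 1) :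
    R.coneSignMatrix s * (R.coneSignMatrix s)ᵀ = (Fintype.card V : ℝ) • 1 := by
  obtain ⟨r, l, hm, hrl, hout, hin, hcommon⟩ := hR.exists_parameters
  have hss : s * s = 1 := by rw [← abs_mul_abs_self, hs, one_mul]
  have hrowsum : ∀ i, ∑ j, (R.adjMatrix i j - R.adjMatrix j i) = 0 := fun i => by
    rw [Finset.sum_sub_distrib, hout, hin, sub_self]
  ext x y
  rw [Matrix.mul_apply, Fintype.sum_option]
  match x, y with
  | none, none => simp [coneSignMatrix, hss]
  | none, some j => simp [coneSignMatrix, ← Finset.mul_sum, hrowsum]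
  | some i, none => simp [coneSignMatrix, ← Finset.sum_mul, hrowsum]
  | some i, some j =>
    by_cases hij : i = j
    · subst hij
      have h : ∑ k, R.coneSignMatrix s (some i) (some k) * R.coneSignMatrix s (some i) (some k)
          = Fintype.card V - 1 := by
        rw [← Finset.add_sum_erase _ _ (Finset.mem_univ i), coneSignMatrix_diag,
          Finset.sum_congr rfl (g := fun _ => (1 : ℝ)) fun k hk => by
            rw [← abs_mul_abs_self, R.abs_coneSignMatrix hs fun e =>
              Finset.ne_of_mem_erase hk (Option.some.inj e).symm, one_mul]]
        simp [Finset.card_erase_of_mem, Nat.cast_sub (Fintype.card_pos_iff.2 ⟨i⟩)]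
      simp only [transpose_apply, h]
      simp [coneSignMatrix, hss]
    · have hentry : ∀ k, (R.adjMatrix i k - R.adjMatrix k i) * (R.adjMatrix j k - R.adjMatrix k j)
          = 4 * (R.adjMatrix i k * R.adjMatrix j k) - 2 * R.adjMatrix i k - 2 * R.adjMatrix j k
            + 1 + ((if j = k then 2 * R.adjMatrix i k - 1 else 0) +
              if i = k then 2 * R.adjMatrix j k - 1 else 0) := fun k => by
        by_cases hik : i = k
        · subst hik
          rw [if_neg (Ne.symm hij), if_pos rfl, adjMatrix_apply_self]
          linarith [R.adjMatrix_add_swap hij]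
        · by_cases hjk : j = k
          · subst hjk
            rw [if_pos rfl, if_neg hij, adjMatrix_apply_self]
            linarith [R.adjMatrix_add_swap hij]
          · rw [if_neg hik, if_neg hjk, ← sub_eq_iff_eq_add'.2 (R.adjMatrix_add_swap hik).symm,
              ← sub_eq_iff_eq_add'.2 (R.adjMatrix_add_swap hjk).symm]
            ring
      have hsum : ∑ k, (R.adjMatrix i k - R.adjMatrix k i) * (R.adjMatrix j k - R.adjMatrix k j)
          = -1 := by
        simp only [hentry, Finset.sum_add_distrib, Finset.sum_sub_distrib, ← Finset.mul_sum,
          hout, hcommon i j hij, Finset.sum_ite_eq, Finset.mem_univ, if_true, Finset.sum_const,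
          Finset.card_univ, nsmul_eq_mul, hm]
        linarith [R.adjMatrix_add_swap hij]
      simp [coneSignMatrix, hss, hsum, hij]

end Tournament

end Cone

/-! ### Forbidding cones -/

/-- A skew-symmetric matrix of rank `2 (d - 1)` does not contain the sign pattern of a cone over a
doubly regular tournament on `12 d ^ 2 - 1` nodes; `g` places the cone, with apex `none`, among the
rows of the matrix. -/
theorem IsSkewNonzero.not_isDoublyRegular_of_cone {n d : ℕ} (hd : 1 ≤ d) {V : Type*} [Fintype V]
    {R : Tournament V} (hV : Fintype.card V = 12 * d ^ 2 - 1)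
    {M : Matrix (Fin n) (Fin n) ℝ} (hM : IsSkewNonzero M) (hrank : M.rank = 2 * (d - 1))
    {s : ℝ} (hs : |s| = 1) (g : Option V → Fin n)
    (hR : ∀ i j, 0 < M (g (some i)) (g (some j)) ↔ R.Adj i j)
    (hapex : ∀ j, 0 < s * M (g none) (g (some j))) : ¬ R.IsDoublyRegular := by
  classical
  intro hreg
  obtain ⟨e, rfl⟩ : ∃ e, d = e + 1 := ⟨d - 1, by omega⟩
  have hcard : Fintype.card V + 1 = 12 * (e + 1) ^ 2 := by
    have : 0 < (e + 1) ^ 2 := by positivity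
    omega
  have : Nontrivial V := Fintype.one_lt_card_iff_nontrivial.1 (by nlinarith)
  have hsign : ∀ x y, x ≠ y → 0 < R.coneSignMatrix s x y * M (g x) (g y) := by
    intro x y hxy
    match x, y with
    | none, none => exact absurd rfl hxy
    | none, some j => exact hapex j
    | some i, none =>
      have h := hapex i
      rw [← neg_mul_neg, ← hM.apply_swap] at h
      exact h
    | some i, some j =>
      rcases R.total i j fun h => hxy (congrArg some h) with h | h <;> have h' := R.asymm _ _ h
      · simpa [Tournament.coneSignMatrix, Tournament.adjMatrix, h, h'] using (hR i j).2 h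
      · have h1 := (hR j i).2 h
        rw [hM.apply_swap] at h1
        simpa [Tournament.coneSignMatrix, Tournament.adjMatrix, h, h'] using h1
  obtain ⟨A, B, hAB⟩ := M.exists_eq_mul_of_rank
  have hsub : ∀ x y, (A.submatrix g id * B.submatrix id g) x y = M (g x) (g y) := fun x y => by
    conv_rhs => rw [hAB]
    rfl
  have hn : Fintype.card (Option V) = 12 * (e + 1) ^ 2 := by rw [Fintype.card_option, hcard]
  have key := sq_card_sub_le_of_sign (k := M.rank) (by rw [hn, hrank]; simp; nlinarith)
    (hreg.coneSignMatrix_mul_transpose hs) (fun x y => R.abs_coneSignMatrix hs)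
    (R.coneSignMatrix_diag s) (U := A.submatrix g id) (V := B.submatrix id g)
    fun x y hxy => by rw [hsub]; exact hsign x y hxy
  have hq : (Fintype.card V : ℝ) = 12 * (e + 1) ^ 2 - 1 := by
    rw [eq_sub_iff_add_eq]
    exact_mod_cast hcard
  rw [hn, hrank, hq] at key
  push_cast [Nat.add_sub_cancel] at key
  have he : (0 : ℝ) ≤ e := e.cast_nonneg
  have h3 : (0 : ℝ) ≤ e ^ 3 := by positivity
  have h4 : (0 : ℝ) ≤ e ^ 4 := by positivity
  nlinarith [sq_nonneg (e : ℝ)]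

theorem mainTheorem5 (d : ℕ) (hd : 1 ≤ d) {V W : Type*} [Fintype V]
    (R : Tournament V) (hV : Fintype.card V = 12 * d ^ 2 - 1) (hR : R.IsDoublyRegular)
    (T : Tournament W) (hT : T.IsCone R) :
    (rankClass (2 * (d - 1))).Forbids T := by
  rintro n _ ⟨M, hM, hrank, rfl⟩ U ⟨φ⟩
  have hφ : ∀ x y, 0 < M (φ.symm x).1 (φ.symm y).1 ↔ T.Adj x y := fun x y =>
    φ.symm.map_rel_iff (a := x) (b := y)
  obtain ⟨i, ⟨-, ⟨ψ⟩⟩ | ⟨-, ⟨ψ⟩⟩⟩ := hT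
  · refine hM.not_isDoublyRegular_of_cone hd hV hrank abs_one
      (fun x => (φ.symm (x.elim i fun v => (ψ.symm v).1)).1)
      (fun v w => (hφ _ _).trans (ψ.symm.map_rel_iff (a := v) (b := w))) (fun v => ?_) hR
    rw [one_mul]
    exact (hφ _ _).2 (ψ.symm v).2
  · refine hM.not_isDoublyRegular_of_cone hd hV hrank (s := -1) (by simp)
      (fun x => (φ.symm (x.elim i fun v => (ψ.symm v).1)).1)
      (fun v w => (hφ _ _).trans (ψ.symm.map_rel_iff (a := v) (b := w))) (fun v => ?_) hR
    rw [neg_one_mul, ← hM.apply_swap]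
    exact (hφ _ _).2 (ψ.symm v).2
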